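/- For a finite group $G$, let $\mathcal{B}(G)$ be the simple bipartite graph whose vertex set is the disjoint union of $G\times G$ and the set of all subgroups of $G$, where $(a,b)\in G\times G$ and a subgroup $H$ are adjacent if and only if $H=\langle a,b\rangle$, and there are no other edges. For a finite simple graph $\Gamma$ with $n$ vertices and $m$ edges, let $A$ be its adjacency matrix, $D$ its diagonal degree matrix, and $CN$ its common neighborhood matrix, i.e. the matrix with zero diagonal whose $(v,w)$ entry for $v\ne w$ is the number of common neighbors of $v$ and $w$. With eigenvalues counted with multiplicity, set $$E(\Gamma)=\sum_{\alpha\in \mathrm{Spec}(A)}|\alpha|,\qquad LE(\Gamma)=\sum_{\lambda\in\mathrm{Spec}(D-A)}\Bigl|\lambda-\frac{2m}{n}\Bigr|,$$ $$LE^+(\Gamma)=\sum_{\mu\in\mathrm{Spec}(D+A)}\Bigl|\mu-\frac{2m}{n}\Bigr|,\qquad E_{CN}(\Gamma)=\sum_{\beta\in\mathrm{Spec}(CN)}|\beta|.$$ Let $K_n$ be the complete graph on $n$ vertices. The graph $\Gamma$ is called hypoenergetic if $E(\Gamma)<n$, hyperenergetic if $E(\Gamma)>E(K_n)$, L-hyperenergetic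 if $LE(\Gamma)>LE(K_n)$, Q-hyperenergetic if $LE^+(\Gamma)>LE^+(K_n)$, and CN-hyperenergetic if $E_{CN}(\Gamma)>E_{CN}(K_n)$. **Theorem.** Let $p$ be a prime and let $G=D_{2p^2}$ be the dihedral group of order $2p^2$. Then $\mathcal{B}(G)$ has exactly $4p^4+p^2+p+4$ vertices, it is hypoenergetic, and it is neither hyperenergetic, nor L-hyperenergetic, nor Q-hyperenergetic, nor CN-hyperenergetic. -/

import Mathlib

noncomputable section

namespace SGB

/-- The multiset of eigenvalues, with multiplicities, of a real square matrix. It is used only for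
symmetric matrices, whose characteristic polynomial has all its roots in `ℝ`. -/
def spec {V : Type*} [Fintype V] [DecidableEq V] (M : Matrix V V ℝ) : Multiset ℝ :=
  M.charpoly.roots

variable {V : Type*} [Fintype V]

open Classical in
/-- The signless Laplacian matrix `D + A`. -/
def signlessLapMatrix (Γ : SimpleGraph V) : Matrix V V ℝ :=
  Γ.degMatrix ℝ + Γ.adjMatrix ℝ

open Classical in
/-- The common neighborhood matrix: the off-diagonal entry at `(v, w)` is the number of common
neighbors of `v` and `w` (none of which is `v` or `w`), and the diagonal is zero. -/
def cnMatrix (Γ : SimpleGraph V) : Matrix V V ℝ :=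
  Matrix.of fun v w => if v = w then 0 else ((Γ.commonNeighbors v w).ncard : ℝ)

open Classical in
/-- The average degree `2 m / n`, where `m` is the number of edges and `n` that of vertices. -/
def avgDegree (Γ : SimpleGraph V) : ℝ :=
  2 * (Γ.edgeFinset.card : ℝ) / (Fintype.card V : ℝ)

open Classical in
/-- The energy `E(Γ)`. -/
def energy (Γ : SimpleGraph V) : ℝ :=
  ((spec (Γ.adjMatrix ℝ)).map fun x => |x|).sum

open Classical in
/-- The Laplacian energy `LE(Γ)`. -/
def lapEnergy (Γ : SimpleGraph V) : ℝ :=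
  ((spec (Γ.lapMatrix ℝ)).map fun x => |x - avgDegree Γ|).sum

open Classical in
/-- The signless Laplacian energy `LE⁺(Γ)`. -/
def signlessLapEnergy (Γ : SimpleGraph V) : ℝ :=
  ((spec (signlessLapMatrix Γ)).map fun x => |x - avgDegree Γ|).sum

open Classical in
/-- The common neighborhood energy `E_CN(Γ)`. -/
def cnEnergy (Γ : SimpleGraph V) : ℝ :=
  ((spec (cnMatrix Γ)).map fun x => |x|).sum

/-- `E(Γ) < n`, where `n` is the number of vertices. -/
def IsHypoenergetic (Γ : SimpleGraph V) : Prop :=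
  energy Γ < (Fintype.card V : ℝ)

/-- `E(Γ) > E(K_n)`, where `n` is the number of vertices. -/
def IsHyperenergetic (Γ : SimpleGraph V) : Prop :=
  energy Γ > energy (⊤ : SimpleGraph (Fin (Fintype.card V)))

/-- `LE(Γ) > LE(K_n)`, where `n` is the number of vertices. -/
def IsLHyperenergetic (Γ : SimpleGraph V) : Prop :=
  lapEnergy Γ > lapEnergy (⊤ : SimpleGraph (Fin (Fintype.card V)))

/-- `LE⁺(Γ) > LE⁺(K_n)`, where `n` is the number of vertices. -/
def IsQHyperenergetic (Γ : SimpleGraph V) : Prop :=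
  signlessLapEnergy Γ > signlessLapEnergy (⊤ : SimpleGraph (Fin (Fintype.card V)))

/-- `E_CN(Γ) > E_CN(K_n)`, where `n` is the number of vertices. -/
def IsCNHyperenergetic (Γ : SimpleGraph V) : Prop :=
  cnEnergy Γ > cnEnergy (⊤ : SimpleGraph (Fin (Fintype.card V)))

/-- The vertex set of the subgroup generating bipartite graph of `G`: the disjoint union of
`G × G` and the set of all subgroups of `G`. -/
abbrev Vertex (G : Type*) [Group G] : Type _ := (G × G) ⊕ Subgroup G

/-- The subgroup generating bipartite graph of `G`: the pair `(a, b)` and the subgroup `H` are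
adjacent exactly when `a` and `b` generate `H`. -/
def sgbGraph (G : Type*) [Group G] : SimpleGraph (Vertex G) where
  Adj
    | .inl x, .inr H => Subgroup.closure {x.1, x.2} = H
    | .inr H, .inl x => Subgroup.closure {x.1, x.2} = H
    | _, _ => False
  symm := ⟨by rintro (x | H) (y | K) h <;> exact h⟩
  loopless := ⟨by rintro (x | H) h <;> exact h⟩

instance vertexFintype (G : Type*) [Group G] [Finite G] : Fintype (Vertex G) :=
  Fintype.ofFinite _

end SGB

end

/-! Each pair generates exactly one subgroup, so the graph is a disjoint union of stars: pairs are
leaves, subgroups are centres. No spectrum is computed. If a symmetric `M` has mean eigenvalue `d`,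
the sum of `|λ - d|` is twice the sum of the positive parts of `d - λ`, hence at most twice the
trace of any positive semidefinite form dominating `d - M` (`sum_abs_sub_le`). Forms built star by
star bound `E` by `2|β| + |α|/2` and the other three energies by `2|α|`, for `|α|` leaves and `|β|`
centres. For `K_n`, the all-ones eigenvector alone gives a lower bound (`two_mul_abs_sub_le`). The
comparison needs only `2|β| < |α|`, which follows from counting the subgroups of the dihedral group.
-/

open SGB Matrix

/-! ### Counting subgroups of dihedral groups -/

/-- A subgroup of the dihedral group, given by its rotations and its coset of reflections. -/
def DihedralGroup.subgroupOfCoset {n : ℕ} (T : AddSubgroup (ZMod n)) (o : Option (ZMod n ⧸ T)) :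
    Subgroup (DihedralGroup n) where
  carrier := {g | match g with
    | .r i => i ∈ T
    | .sr i => some (i : ZMod n ⧸ T) = o}
  one_mem' := T.zero_mem
  mul_mem' := by
    rintro (i | i) (j | j) hi hj
    · exact T.add_mem hi hj
    · change some _ = o at hj
      change i ∈ T at hi
      change some _ = o
      rw [← hj, Option.some_inj, QuotientAddGroup.eq]
      simpa using hi
    · change some _ = o at hi
      change j ∈ T at hj
      change some _ = o
      rw [← hi, Option.some_inj, QuotientAddGroup.eq]
      simpa using hj
    · change some _ = o at hi
      change some _ = o at hj
      change j - i ∈ T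
      rw [← hj, Option.some_inj, QuotientAddGroup.eq] at hi
      simpa [sub_eq_neg_add] using hi
  inv_mem' := by
    rintro (i | i) hi
    · exact T.neg_mem hi
    · exact hi

namespace DihedralGroup

variable {n : ℕ}

theorem r_mem_subgroupOfCoset {T : AddSubgroup (ZMod n)} {o : Option (ZMod n ⧸ T)} {i : ZMod n} :
    r i ∈ subgroupOfCoset T o ↔ i ∈ T := Iff.rfl

theorem sr_mem_subgroupOfCoset {T : AddSubgroup (ZMod n)} {o : Option (ZMod n ⧸ T)} {i : ZMod n} :
    sr i ∈ subgroupOfCoset T o ↔ some (i : ZMod n ⧸ T) = o := Iff.rfl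

/-- The product of two reflections is a rotation, so the reflections in a subgroup, if there are
any, fill a single coset of its rotations. -/
theorem subgroupOfCoset_bijective :
    Function.Bijective fun x : Σ T : AddSubgroup (ZMod n), Option (ZMod n ⧸ T) =>
      subgroupOfCoset x.1 x.2 := by
  constructor
  · rintro ⟨T, o⟩ ⟨T', o'⟩ h
    dsimp only at h
    obtain rfl : T = T' := by
      ext i
      rw [← r_mem_subgroupOfCoset (o := o), h, r_mem_subgroupOfCoset]
    congr 1
    ext c
    obtain ⟨i, rfl⟩ := QuotientAddGroup.mk_surjective c
    have hi : sr i ∈ subgroupOfCoset T o ↔ sr i ∈ subgroupOfCoset T o' := by rw [h]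
    rw [sr_mem_subgroupOfCoset, sr_mem_subgroupOfCoset] at hi
    simpa [eq_comm] using hi
  · intro H
    let T : AddSubgroup (ZMod n) :=
      { carrier := {i | r i ∈ H}
        zero_mem' := H.one_mem
        add_mem' := fun hi hj => H.mul_mem hi hj
        neg_mem' := fun hi => H.inv_mem hi }
    have hT (i : ZMod n) : i ∈ T ↔ r i ∈ H := Iff.rfl
    by_cases h : ∃ i, sr i ∈ H
    · obtain ⟨i, hi⟩ := h
      refine ⟨⟨T, some (i : ZMod n ⧸ T)⟩, ?_⟩
      ext (j | j)
      · exact Iff.rfl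
      · rw [sr_mem_subgroupOfCoset, Option.some_inj, QuotientAddGroup.eq, hT, ← H.mul_mem_cancel_left hi]
        have hji : r (-j + i) = sr j * sr i := by simp [sub_eq_neg_add]
        rw [hji, ← mul_assoc, H.mul_mem_cancel_right hi, ← H.mul_mem_cancel_left hi,
          ← mul_assoc, sr_mul_self, one_mul]
    · refine ⟨⟨T, none⟩, ?_⟩
      ext (j | j)
      · exact Iff.rfl
      · rw [sr_mem_subgroupOfCoset]
        simpa using fun hj => h ⟨j, hj⟩

end DihedralGroup

theorem ZMod.index_zmultiples_natCast {n : ℕ} [NeZero n] {d : ℕ} (hd : d ∣ n) :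
    (AddSubgroup.zmultiples (d : ZMod n)).index = d := by
  have h := (AddSubgroup.zmultiples (d : ZMod n)).index_mul_card
  rw [Nat.card_zmultiples, ZMod.addOrderOf_coe _ (NeZero.ne n), Nat.gcd_eq_right hd,
    Nat.card_zmod] at h
  obtain ⟨e, rfl⟩ := hd
  have hn := NeZero.ne (d * e)
  rw [Nat.mul_div_cancel_left _ (Nat.pos_of_ne_zero (left_ne_zero_of_mul hn))] at h
  exact Nat.eq_of_mul_eq_mul_right (Nat.pos_of_ne_zero (right_ne_zero_of_mul hn)) h

theorem ZMod.eq_zmultiples_index {n : ℕ} [NeZero n] (T : AddSubgroup (ZMod n)) :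
    AddSubgroup.zmultiples (T.index : ZMod n) = T := by
  have hle : AddSubgroup.zmultiples (T.index : ZMod n) ≤ T := by
    rw [AddSubgroup.zmultiples_le]
    simpa using T.nsmul_index_mem (1 : ZMod n)
  have hd : T.index ∣ n := by simpa using T.index_dvd_card
  refine AddSubgroup.eq_of_le_of_card_ge hle ?_
  have h1 := (AddSubgroup.zmultiples (T.index : ZMod n)).index_mul_card
  rw [ZMod.index_zmultiples_natCast hd, ← T.index_mul_card] at h1
  exact (Nat.eq_of_mul_eq_mul_left (Nat.pos_of_ne_zero T.index_ne_zero_of_finite) h1).ge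

theorem ZMod.sum_addSubgroup_index {n : ℕ} [NeZero n] [Fintype (AddSubgroup (ZMod n))]
    (g : ℕ → ℕ) : ∑ T : AddSubgroup (ZMod n), g T.index = ∑ d ∈ n.divisors, g d := by
  refine Finset.sum_bij (fun T _ => T.index) ?_ ?_ ?_ (fun _ _ => rfl)
  · intro T _
    exact Nat.mem_divisors.2 ⟨by simpa using T.index_dvd_card, NeZero.ne n⟩
  · intro T _ T' _ h
    rw [← ZMod.eq_zmultiples_index T, h, ZMod.eq_zmultiples_index]
  · intro d hd
    exact ⟨_, Finset.mem_univ _, ZMod.index_zmultiples_natCast (Nat.dvd_of_mem_divisors hd)⟩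

/-- A rotation subgroup of index `d` admits `d` cosets of reflections, or none: `d + 1` choices. -/
theorem DihedralGroup.card_subgroup {n : ℕ} [NeZero n] :
    Nat.card (Subgroup (DihedralGroup n)) = ∑ d ∈ n.divisors, (d + 1) := by
  classical
  have := Fintype.ofFinite (AddSubgroup (ZMod n))
  rw [← Nat.card_eq_of_bijective _ subgroupOfCoset_bijective, Nat.card_sigma,
    ← ZMod.sum_addSubgroup_index]
  exact Finset.sum_congr rfl fun T _ => by rw [Finite.card_option]; rfl

theorem DihedralGroup.card_subgroup_prime_sq (p : ℕ) [hp : Fact p.Prime] :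
    Nat.card (Subgroup (DihedralGroup (p ^ 2))) = p ^ 2 + p + 4 := by
  rw [card_subgroup, Nat.sum_divisors_prime_pow hp.out]
  simp [Finset.sum_range_succ]
  ring

/-! ### Unions of stars as graphs of functions -/

/-- The graph on `α ⊕ β` joining each `a` to `f a` only. -/
def SimpleGraph.ofFun {α β : Type*} (f : α → β) : SimpleGraph (α ⊕ β) where
  Adj
    | .inl a, .inr b => f a = b
    | .inr b, .inl a => f a = b
    | _, _ => False
  symm := ⟨by rintro (x | H) (y | K) h <;> exact h⟩
  loopless := ⟨by rintro (x | H) h <;> exact h⟩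

namespace SimpleGraph

variable {α β : Type*} {f : α → β}

@[simp]
theorem ofFun_adj_inl_inl {a a' : α} : ¬ (ofFun f).Adj (.inl a) (.inl a') := id

@[simp]
theorem ofFun_adj_inl_inr {a : α} {b : β} : (ofFun f).Adj (.inl a) (.inr b) ↔ f a = b := by exact Iff.rfl

@[simp]
theorem ofFun_adj_inr_inl {a : α} {b : β} : (ofFun f).Adj (.inr b) (.inl a) ↔ f a = b := by exact Iff.rfl

@[simp]
theorem ofFun_adj_inr_inr {b b' : β} : ¬ (ofFun f).Adj (.inr b) (.inr b') := id

end SimpleGraph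

theorem SGB.sgbGraph_eq_ofFun (G : Type*) [Group G] :
    sgbGraph G = SimpleGraph.ofFun fun x : G × G => Subgroup.closure {x.1, x.2} := by
  ext (x | H) (y | K) <;> rfl

/-! ### Bounding spectral deviations by traces and by single eigenvectors -/

theorem Matrix.IsHermitian.sum_map_spec {V : Type*} [Fintype V] [DecidableEq V]
    {M : Matrix V V ℝ} (hM : M.IsHermitian) (g : ℝ → ℝ) :
    ((spec M).map g).sum = ∑ i, g (hM.eigenvalues i) := by
  rw [spec, hM.roots_charpoly_eq_eigenvalues, Multiset.map_map]
  rfl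

theorem OrthonormalBasis.sum_dotProduct_sq {V : Type*} [Fintype V]
    (u : OrthonormalBasis V ℝ (EuclideanSpace ℝ V)) (b : V → ℝ) :
    ∑ i, (b ⬝ᵥ (u i : V → ℝ)) ^ 2 = ∑ i, b i ^ 2 := by
  have h := u.sum_sq_norm_inner_right (WithLp.toLp 2 b)
  rw [EuclideanSpace.norm_sq_eq] at h
  simpa [PiLp.inner_apply, dotProduct, mul_comm] using h

theorem OrthonormalBasis.dotProduct_self {V : Type*} [Fintype V]
    (u : OrthonormalBasis V ℝ (EuclideanSpace ℝ V)) (i : V) :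
    (u i : V → ℝ) ⬝ᵥ (u i : V → ℝ) = 1 := by
  have h := real_inner_self_eq_norm_sq (u i)
  rw [u.orthonormal.1 i, PiLp.inner_apply] at h
  simpa [dotProduct, sq] using h

/-- If `d - M` is bounded above by a sum of weighted squares of the rows of `B`, this controls the
absolute deviation of the spectrum of `M` from its mean `d`. -/
theorem SGB.sum_abs_sub_le {V W : Type*} [Fintype V] [DecidableEq V] [Fintype W]
    {M : Matrix V V ℝ} (hM : M.IsHermitian) {d : ℝ} (htr : M.trace = d * Fintype.card V)
    (B : Matrix W V ℝ) {w : W → ℝ} (hw : ∀ j, 0 ≤ w j)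
    (h : ∀ x : V → ℝ, d * (x ⬝ᵥ x) - x ⬝ᵥ M *ᵥ x ≤ ∑ j, w j * (B *ᵥ x) j ^ 2) :
    ((spec M).map fun x => |x - d|).sum ≤ 2 * ∑ j, w j * ∑ i, B j i ^ 2 := by
  rw [hM.sum_map_spec fun x => |x - d|]
  set u := hM.eigenvectorBasis
  have htr' : ∑ i, (hM.eigenvalues i - d) = 0 := by
    rw [Finset.sum_sub_distrib, sub_eq_zero]
    have := hM.trace_eq_sum_eigenvalues
    simp only [RCLike.ofReal_real_eq_id, id_eq] at this
    rw [← this, htr]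
    simp [mul_comm]
  -- If `q ≥ 0` and `-t ≤ q`, then `|t| ≤ t + 2 * q`. In the sum over `i` the terms `t` cancel, and
  -- Parseval turns the `q` into row norms of `B`.
  have hs (i : V) : |hM.eigenvalues i - d| ≤
      (hM.eigenvalues i - d) + 2 * ∑ j, w j * (B *ᵥ (u i : V → ℝ)) j ^ 2 := by
    have h0 : 0 ≤ ∑ j, w j * (B *ᵥ (u i : V → ℝ)) j ^ 2 :=
      Finset.sum_nonneg fun j _ => mul_nonneg (hw j) (sq_nonneg _)
    have h1 := h (u i)
    have h2 : M *ᵥ (u i : V → ℝ) = hM.eigenvalues i • (u i : V → ℝ) :=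
      hM.mulVec_eigenvectorBasis i
    rw [h2, dotProduct_smul, u.dotProduct_self, smul_eq_mul] at h1
    rw [abs_le]
    constructor <;> linarith
  refine (Finset.sum_le_sum fun i _ => hs i).trans_eq ?_
  rw [Finset.sum_add_distrib, htr', zero_add, ← Finset.mul_sum, Finset.sum_comm]
  congr 1
  refine Finset.sum_congr rfl fun j _ => ?_
  rw [← Finset.mul_sum, ← u.sum_dotProduct_sq (B j)]
  rfl

/-- The other elements sum to `-x`, so they contribute at least `|x|` as well. -/
theorem Multiset.two_mul_abs_le_of_sum_eq_zero {s : Multiset ℝ} (hs : s.sum = 0) {x : ℝ}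
    (hx : x ∈ s) : 2 * |x| ≤ (s.map fun y => |y|).sum := by
  obtain ⟨t, rfl⟩ := Multiset.exists_cons_of_mem hx
  rw [Multiset.sum_cons] at hs
  rw [Multiset.map_cons, Multiset.sum_cons, two_mul]
  have h := t.abs_sum_le_sum_abs
  rw [← neg_eq_of_add_eq_zero_right hs, abs_neg] at h
  linarith

theorem SGB.two_mul_abs_sub_le {V : Type*} [Fintype V] [DecidableEq V]
    {M : Matrix V V ℝ} (hM : M.IsHermitian) {d : ℝ} (htr : M.trace = d * Fintype.card V)
    {v : V → ℝ} (hv : v ≠ 0) {μ : ℝ} (h : M *ᵥ v = μ • v) :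
    2 * |μ - d| ≤ ((spec M).map fun x => |x - d|).sum := by
  have hμ : μ ∈ spec M := by
    rw [spec, Polynomial.mem_roots M.charpoly_monic.ne_zero,
      ← Matrix.mem_spectrum_iff_isRoot_charpoly, ← Matrix.spectrum_toLin']
    exact (Module.End.hasEigenvalue_of_hasEigenvector
      ⟨Module.End.mem_eigenspace_iff.2 (by simpa using h), hv⟩).mem_spectrum
  have hsum : ((spec M).map fun x => x - d).sum = 0 := by
    rw [hM.sum_map_spec fun x => x - d, Finset.sum_sub_distrib, sub_eq_zero]
    have := hM.trace_eq_sum_eigenvalues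
    simp only [RCLike.ofReal_real_eq_id, id_eq] at this
    rw [← this, htr]
    simp [mul_comm]
  simpa [Multiset.map_map, Function.comp_def] using
    Multiset.two_mul_abs_le_of_sum_eq_zero hsum (Multiset.mem_map_of_mem _ hμ)

namespace SGB

section General

theorem isHermitian_cnMatrix {V : Type*} (Γ : SimpleGraph V) : (cnMatrix Γ).IsHermitian := by
  ext v w
  by_cases h : v = w
  · simp [cnMatrix, h]
  · simp [cnMatrix, h, Ne.symm h, SimpleGraph.commonNeighbors_symm Γ w]

variable {V : Type*} [Fintype V]

theorem trace_degMatrix [Nonempty V] [DecidableEq V] (Γ : SimpleGraph V) [DecidableRel Γ.Adj] :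
    (Γ.degMatrix ℝ).trace = avgDegree Γ * Fintype.card V := by
  rw [avgDegree, div_mul_cancel₀ _ (by positivity), SimpleGraph.degMatrix, Matrix.trace_diagonal]
  convert! congr_arg (Nat.cast (R := ℝ)) Γ.sum_degrees_eq_twice_card_edges
  · push_cast
    rfl
  · push_cast
    congr!

theorem trace_degMatrix_add_smul [Nonempty V] [DecidableEq V] (Γ : SimpleGraph V)
    [DecidableRel Γ.Adj] (s : ℝ) :
    (Γ.degMatrix ℝ + s • Γ.adjMatrix ℝ).trace = avgDegree Γ * Fintype.card V := by
  rw [Matrix.trace_add, trace_degMatrix, Matrix.trace_smul, SimpleGraph.trace_adjMatrix]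
  simp

theorem isHermitian_degMatrix_add_smul [DecidableEq V] (Γ : SimpleGraph V) [DecidableRel Γ.Adj]
    (s : ℝ) :
    (Γ.degMatrix ℝ + s • Γ.adjMatrix ℝ).IsHermitian := by
  rw [IsHermitian, conjTranspose_eq_transpose_of_trivial]
  exact (Γ.isSymm_degMatrix ℝ).add ((Γ.isSymm_adjMatrix (α := ℝ)).smul s)

theorem trace_cnMatrix (Γ : SimpleGraph V) : (cnMatrix Γ).trace = 0 := by
  simp [Matrix.trace, cnMatrix]

open Classical in
theorem lapEnergy_eq (Γ : SimpleGraph V) : lapEnergy Γ =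
    ((spec (Γ.degMatrix ℝ + (-1 : ℝ) • Γ.adjMatrix ℝ)).map fun x => |x - avgDegree Γ|).sum := by
  rw [lapEnergy, SimpleGraph.lapMatrix, neg_one_smul, ← sub_eq_add_neg]

open Classical in
theorem signlessLapEnergy_eq (Γ : SimpleGraph V) : signlessLapEnergy Γ =
    ((spec (Γ.degMatrix ℝ + (1 : ℝ) • Γ.adjMatrix ℝ)).map fun x => |x - avgDegree Γ|).sum := by
  rw [signlessLapEnergy, signlessLapMatrix, one_smul]

end General

/-! ### Lower bounds from the all-ones vector -/

section Regular

variable {V : Type*} [Fintype V] {Γ : SimpleGraph V} {k : ℕ}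

open Classical in
theorem adjMatrix_mulVec_one (h : Γ.IsRegularOfDegree k) :
    Γ.adjMatrix ℝ *ᵥ 1 = (k : ℝ) • (1 : V → ℝ) := by
  ext v
  rw [SimpleGraph.adjMatrix_mulVec_apply]
  simp [h v]

open Classical in
theorem degMatrix_mulVec_one (h : Γ.IsRegularOfDegree k) :
    Γ.degMatrix ℝ *ᵥ 1 = (k : ℝ) • (1 : V → ℝ) := by
  ext v
  simp [SimpleGraph.degMatrix, mulVec_diagonal, h v]

open Classical in
theorem avgDegree_of_isRegularOfDegree [Nonempty V] (h : Γ.IsRegularOfDegree k) : avgDegree Γ = k := by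
  have hc : (Fintype.card V : ℝ) ≠ 0 := by positivity
  apply mul_right_cancel₀ hc
  rw [← trace_degMatrix]
  simp [SimpleGraph.degMatrix, Matrix.trace_diagonal, h _, mul_comm]

open Classical in
theorem two_mul_le_energy [Nonempty V] (h : Γ.IsRegularOfDegree k) : 2 * (k : ℝ) ≤ energy Γ := by
  have h := two_mul_abs_sub_le (Γ.isHermitian_adjMatrix ℝ) (d := 0)
    (by simp) one_ne_zero (adjMatrix_mulVec_one h)
  simp only [sub_zero] at h
  exact (mul_le_mul_of_nonneg_left (le_abs_self _) zero_le_two).trans h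

open Classical in
-- The sign `s = -1` is the Laplacian and `s = 1` the signless one; the eigenvalue `k + s * k` lies
-- at distance `k` from the mean `k`.
theorem two_mul_le_sum_abs_degMatrix [Nonempty V] (h : Γ.IsRegularOfDegree k) {s : ℝ} (hs : |s| = 1) :
    2 * (k : ℝ) ≤
      ((spec (Γ.degMatrix ℝ + s • Γ.adjMatrix ℝ)).map fun x => |x - avgDegree Γ|).sum := by
  have key := two_mul_abs_sub_le (isHermitian_degMatrix_add_smul Γ s)
    (trace_degMatrix_add_smul _ s) one_ne_zero (μ := k + s * k) (by
      rw [add_mulVec, smul_mulVec, adjMatrix_mulVec_one h, degMatrix_mulVec_one h, smul_smul,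
        ← add_smul])
  refine le_trans ?_ key
  rw [avgDegree_of_isRegularOfDegree h, add_sub_cancel_left, abs_mul, hs, one_mul]
  exact mul_le_mul_of_nonneg_left (le_abs_self _) zero_le_two

theorem isRegularOfDegree_top {_ : (⊤ : SimpleGraph V).LocallyFinite} :
    (⊤ : SimpleGraph V).IsRegularOfDegree (Fintype.card V - 1) := by
  classical
  intro v
  rw [← SimpleGraph.IsRegularOfDegree.top v]
  congr!

/-- With `n` vertices the matrix is `(n - 2) (J - I)`, where `J` is the all-ones matrix. -/
theorem cnMatrix_top_mulVec_one [Nonempty V] : cnMatrix (⊤ : SimpleGraph V) *ᵥ 1 =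
    (((Fintype.card V : ℝ) - 1) * ((Fintype.card V : ℝ) - 2)) • (1 : V → ℝ) := by
  classical
  have h (v w : V) : cnMatrix (⊤ : SimpleGraph V) v w =
      ((Fintype.card V : ℝ) - 2) - if v = w then (Fintype.card V : ℝ) - 2 else 0 := by
    by_cases hvw : v = w
    · simp [cnMatrix, hvw]
    · have h2 : 2 ≤ Fintype.card V := by
        rw [← Finset.card_pair hvw]; exact Finset.card_le_univ _
      have hc := SimpleGraph.card_commonNeighbors_top hvw
      rw [← Nat.card_eq_fintype_card, Nat.card_coe_set_eq] at hc
      simp [cnMatrix, hvw, hc, Nat.cast_sub h2]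
  ext v
  simp [mulVec, dotProduct, h]
  ring

theorem cnEnergy_top_ge [Nonempty V] :
    2 * (((Fintype.card V : ℝ) - 1) * ((Fintype.card V : ℝ) - 2)) ≤
      cnEnergy (⊤ : SimpleGraph V) := by
  classical
  have h := two_mul_abs_sub_le (isHermitian_cnMatrix (⊤ : SimpleGraph V)) (d := 0)
    (by rw [trace_cnMatrix, zero_mul]) one_ne_zero cnMatrix_top_mulVec_one
  simp only [sub_zero] at h
  exact (mul_le_mul_of_nonneg_left (le_abs_self _) zero_le_two).trans h

end Regular

end SGB

/-! ### Upper bounds for unions of stars -/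

namespace SGB

variable {α β : Type*} (f : α → β)

open Classical in
/-- The incidence matrix of the fibres of `f`. -/
noncomputable def fiberMatrix : Matrix β α ℝ := Matrix.of fun b a => if f a = b then 1 else 0

theorem commonNeighbors_ofFun_inl (a a' : α) [Decidable (f a = f a')] :
    (SimpleGraph.ofFun f).commonNeighbors (.inl a) (.inl a') =
      if f a = f a' then {Sum.inr (f a)} else ∅ := by
  ext (c | c)
  · split_ifs <;> simp [SimpleGraph.mem_commonNeighbors]
  · split_ifs with h
    · simp [SimpleGraph.mem_commonNeighbors, ← h, eq_comm]
    · simp only [SimpleGraph.mem_commonNeighbors, SimpleGraph.ofFun_adj_inl_inr,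
        Set.mem_empty_iff_false, iff_false]
      rintro ⟨rfl, h'⟩
      exact h h'.symm

theorem adjMatrix_ofFun [DecidableRel (SimpleGraph.ofFun f).Adj] : (SimpleGraph.ofFun f).adjMatrix ℝ =
    fromBlocks 0 (fiberMatrix f)ᵀ (fiberMatrix f) 0 := by
  classical
  ext (a | b) (a' | b') <;> simp [fiberMatrix, SimpleGraph.adjMatrix_apply]

theorem cnMatrix_ofFun [Fintype β] [DecidableEq α] : cnMatrix (SimpleGraph.ofFun f) =
    fromBlocks ((fiberMatrix f)ᵀ * fiberMatrix f - 1) 0 0 0 := by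
  classical
  ext (a | b) (a' | b')
  · by_cases ha : a = a'
    · subst ha
      simp [cnMatrix, fiberMatrix, mul_apply]
    · by_cases hf : f a = f a'
      · simp [cnMatrix, commonNeighbors_ofFun_inl, ha, hf, fiberMatrix, mul_apply]
      · simp [cnMatrix, commonNeighbors_ofFun_inl, ha, hf, fiberMatrix, mul_apply, eq_comm]
  · have : (SimpleGraph.ofFun f).commonNeighbors (.inl a) (.inr b') = ∅ := by
      ext (c | c) <;> simp [SimpleGraph.mem_commonNeighbors]
    simp [cnMatrix, this]
  · have : (SimpleGraph.ofFun f).commonNeighbors (.inr b) (.inl a') = ∅ := by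
      ext (c | c) <;> simp [SimpleGraph.mem_commonNeighbors]
    simp [cnMatrix, this]
  · by_cases hb : b = b'
    · simp [cnMatrix, hb]
    · have : (SimpleGraph.ofFun f).commonNeighbors (.inr b) (.inr b') = ∅ := by
        ext (c | c)
        · simp only [SimpleGraph.mem_commonNeighbors, SimpleGraph.ofFun_adj_inr_inl,
            Set.mem_empty_iff_false, iff_false]
          rintro ⟨h, h'⟩
          exact hb (h.symm.trans h')
        · simp [SimpleGraph.mem_commonNeighbors]
      simp [cnMatrix, this]

variable [Fintype α]

open Classical in
/-- The number of elements in the fibre of `f` over `b`. -/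
noncomputable def fiberCard (b : β) : ℝ := (Finset.univ.filter fun a => f a = b).card

theorem fiberMatrix_mulVec_eq_zero {b : β} (hb : fiberCard f b = 0) (x : α → ℝ) :
    (fiberMatrix f *ᵥ x) b = 0 := by
  classical
  have hb' : ∀ a, f a ≠ b := by simpa [fiberCard, Finset.filter_eq_empty_iff] using hb
  simp [fiberMatrix, mulVec, dotProduct, hb']

variable [Fintype β]

theorem sum_fiberCard : ∑ b, fiberCard f b = Fintype.card α := by
  classical
  simp only [fiberCard]
  rw [← Nat.cast_sum, ← Finset.card_eq_sum_card_fiberwise (fun a _ => Finset.mem_univ (f a))]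
  rfl

theorem degMatrix_ofFun [DecidableEq α] [DecidableEq β] [DecidableEq (α ⊕ β)]
    [DecidableRel (SimpleGraph.ofFun f).Adj] : (SimpleGraph.ofFun f).degMatrix ℝ =
      fromBlocks 1 0 0 (diagonal (fiberCard f)) := by
  have h (v : α ⊕ β) : ((SimpleGraph.ofFun f).degree v : ℝ) =
      Sum.elim (fun _ => 1) (fiberCard f) v := by
    rw [SimpleGraph.degree_eq_sum_if_adj]
    obtain a | b := v <;> rw [Fintype.sum_sum_type] <;> simp [fiberCard]
    congr!
  rw [SimpleGraph.degMatrix, ← diagonal_one, fromBlocks_diagonal, ← funext h]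
  ext v w
  simp [diagonal_apply]

theorem neg_dotProduct_self_le_cnMatrix_ofFun (x : α → ℝ) (y : β → ℝ) :
    -(x ⬝ᵥ x) ≤ Sum.elim x y ⬝ᵥ cnMatrix (SimpleGraph.ofFun f) *ᵥ Sum.elim x y := by
  classical
  have h : 0 ≤ (fiberMatrix f *ᵥ x) ⬝ᵥ (fiberMatrix f *ᵥ x) :=
    Finset.sum_nonneg fun b _ => mul_self_nonneg _
  rw [cnMatrix_ofFun]
  simpa [fromBlocks_mulVec, sumElim_dotProduct_sumElim, sub_mulVec, dotProduct_sub,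
    ← mulVec_mulVec, dotProduct_transpose_mulVec] using h

/-- The dominating form has weight `c` on every leaf and, for each star, weight `g b` on the square
of the centre plus `t` times the leaf sum. -/
theorem sum_abs_sub_le_of_fiber [DecidableEq (α ⊕ β)] {M : Matrix (α ⊕ β) (α ⊕ β) ℝ}
    (hM : M.IsHermitian) {d : ℝ} (htr : M.trace = d * Fintype.card (α ⊕ β)) (t : ℝ)
    {c : ℝ} (hc : 0 ≤ c) {g : β → ℝ} (hg : ∀ b, 0 ≤ g b)
    (h : ∀ (x : α → ℝ) (y : β → ℝ),
      d * (x ⬝ᵥ x + y ⬝ᵥ y) - Sum.elim x y ⬝ᵥ M *ᵥ Sum.elim x y ≤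
        c * (x ⬝ᵥ x) + ∑ b, g b * (t * (fiberMatrix f *ᵥ x) b + y b) ^ 2) :
    ((spec M).map fun x => |x - d|).sum ≤
      2 * (c * Fintype.card α + ∑ b, g b * (t ^ 2 * fiberCard f b + 1)) := by
  classical
  have key := sum_abs_sub_le (W := α ⊕ β) hM htr (fromBlocks 1 0 (t • fiberMatrix f) 1)
    (w := Sum.elim (fun _ => c) g) (by rintro (a | b); exacts [hc, hg b]) (by
      intro z
      obtain ⟨x, y, rfl⟩ : ∃ x y, Sum.elim x y = z := ⟨_, _, Sum.elim_comp_inl_inr z⟩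
      have := h x y
      rw [Fintype.sum_sum_type]
      simpa [fromBlocks_mulVec, sumElim_dotProduct_sumElim, smul_mulVec,
        dotProduct, Finset.mul_sum, sq] using this)
  refine key.trans_eq ?_
  rw [Fintype.sum_sum_type]
  simp [Fintype.sum_sum_type, Matrix.one_apply, fiberMatrix, fiberCard, Finset.sum_ite, mul_comm]

/-- A star with `m` leaves has energy `2√m ≤ 2 + m / 2`. In quadratic forms, with `h` the leaf sum:
`-2yh = (y - h/2)² - (y + h/2)²`. -/
theorem energy_ofFun_le : energy (SimpleGraph.ofFun f) ≤
    2 * Fintype.card β + Fintype.card α / 2 := by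
  classical
  -- Pins the instance used in `energy`, in place of the one for sum types.
  let _ : DecidableEq (α ⊕ β) := fun _ _ => Classical.propDecidable _
  have h := sum_abs_sub_le_of_fiber f ((SimpleGraph.ofFun f).isHermitian_adjMatrix ℝ) (d := 0)
    (by simp) (-(1 / 2)) le_rfl (g := 1) (by simp) (by
      intro x y
      rw [adjMatrix_ofFun]
      simp only [fromBlocks_mulVec, sumElim_dotProduct_sumElim, Sum.elim_comp_inl, Sum.elim_comp_inr,
        zero_mulVec, zero_add, add_zero, zero_mul, zero_sub, Pi.one_apply, one_mul,
        dotProduct_transpose_mulVec]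
      simp only [dotProduct, ← Finset.sum_add_distrib, ← Finset.sum_neg_distrib]
      refine Finset.sum_le_sum fun b _ => ?_
      nlinarith [sq_nonneg (y b + (fiberMatrix f *ᵥ x) b / 2)])
  simp only [sub_zero] at h
  change energy _ ≤ _ at h
  refine h.trans_eq ?_
  simp [Finset.sum_add_distrib, ← Finset.mul_sum, sum_fiberCard]
  ring

/-- On leaves the matrix is a Gram matrix minus the identity, so its negative is at most the
identity there and `0` on centres. -/
theorem cnEnergy_ofFun_le : cnEnergy (SimpleGraph.ofFun f) ≤ 2 * Fintype.card α := by
  classical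
  let _ : DecidableEq (α ⊕ β) := fun _ _ => Classical.propDecidable _
  have h := sum_abs_sub_le_of_fiber f (isHermitian_cnMatrix (SimpleGraph.ofFun f)) (d := 0)
    (by simp [trace_cnMatrix]) 0 zero_le_one (g := 0) (by simp) (by
      intro x y
      have := neg_dotProduct_self_le_cnMatrix_ofFun f x y
      simp
      linarith)
  simpa [cnEnergy] using h

theorem avgDegree_ofFun_mul [Nonempty β] : avgDegree (SimpleGraph.ofFun f) *
    (Fintype.card α + Fintype.card β) = 2 * Fintype.card α := by
  classical
  have h := trace_degMatrix (SimpleGraph.ofFun f)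
  rw [degMatrix_ofFun] at h
  simp [Matrix.trace, Fintype.sum_sum_type, sum_fiberCard] at h
  linarith

/-- After multiplication by `m * (m + 1)`, the difference of the two sides is the sum of the
nonnegative terms `h1` and `h2`. -/
theorem laplacian_fiber_bound {d m s h y : ℝ} (hd : 1 ≤ d) (hd2 : d ≤ 2)
    (hm : 1 ≤ m) :
    d * h ^ 2 - m * h ^ 2 - 2 * s * (y * h) ≤ d / (m + 1) * (-s * y + h) ^ 2 := by
  have he : 0 ≤ m + 1 - d := by linarith
  have h1 : 0 ≤ (m + 1 - d) * (m * h + s * y) ^ 2 := mul_nonneg he (sq_nonneg _)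
  have h2 : 0 ≤ (m + 1) * (d - 1) * (s * y) ^ 2 :=
    mul_nonneg (mul_nonneg (by linarith) (by linarith)) (sq_nonneg _)
  rw [div_mul_eq_mul_div, le_div_iff₀ (by linarith)]
  refine le_of_mul_le_mul_left ?_ (by linarith : 0 < m)
  linarith

theorem sum_abs_degMatrix_ofFun_le [Nonempty β] {_ : DecidableEq (α ⊕ β)}
    {_ : DecidableRel (SimpleGraph.ofFun f).Adj} (hcard : Fintype.card β ≤ Fintype.card α)
    {s : ℝ} (hs : s ^ 2 = 1) :
    ((spec ((SimpleGraph.ofFun f).degMatrix ℝ + s • (SimpleGraph.ofFun f).adjMatrix ℝ)).map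
        fun x => |x - avgDegree (SimpleGraph.ofFun f)|).sum ≤ 2 * Fintype.card α := by
  classical
  set d := avgDegree (SimpleGraph.ofFun f)
  have hdm : d * (Fintype.card α + Fintype.card β) = 2 * Fintype.card α := avgDegree_ofFun_mul f
  have hβ : (0 : ℝ) < Fintype.card β := by exact_mod_cast Fintype.card_pos
  have hαβ : (Fintype.card β : ℝ) ≤ Fintype.card α := by exact_mod_cast hcard
  have hd1 : 1 ≤ d := by nlinarith
  have hd2 : d ≤ 2 := by nlinarith
  have hm (b : β) : 0 < fiberCard f b + 1 := by unfold fiberCard; positivity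
  -- On a star, the vector equal to `-s` on leaves and `1` at the centre spans the kernel of `D +
  -- sA` and has squared norm `fiberCard f b + 1`; the weight makes its term `d` times the
  -- projection onto it.
  have h := sum_abs_sub_le_of_fiber f (isHermitian_degMatrix_add_smul (SimpleGraph.ofFun f) s)
    (trace_degMatrix_add_smul _ s) (-s) (c := d - 1) (by linarith)
    (g := fun b => d / (fiberCard f b + 1))
    (fun b => div_nonneg (by linarith) (hm b).le) (by
      intro x y
      rw [adjMatrix_ofFun, degMatrix_ofFun]
      simp only [add_mulVec, smul_mulVec, dotProduct_add, dotProduct_smul,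
        fromBlocks_mulVec, sumElim_dotProduct_sumElim, Sum.elim_comp_inl, Sum.elim_comp_inr,
        zero_mulVec, zero_add, add_zero, one_mulVec, smul_eq_mul,
        dotProduct_transpose_mulVec]
      have key : d * (y ⬝ᵥ y) - y ⬝ᵥ diagonal (fiberCard f) *ᵥ y - 2 * s * (fiberMatrix f *ᵥ x ⬝ᵥ y)
          ≤ ∑ b, d / (fiberCard f b + 1) * (-s * (fiberMatrix f *ᵥ x) b + y b) ^ 2 := by
        simp only [dotProduct, mulVec_diagonal, Finset.mul_sum, ← Finset.sum_sub_distrib]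
        refine Finset.sum_le_sum fun b _ => ?_
        obtain hb | hb := Nat.eq_zero_or_pos (Finset.univ.filter fun a => f a = b).card
        · have hb' : fiberCard f b = 0 := by simp only [fiberCard, hb, Nat.cast_zero]
          rw [fiberMatrix_mulVec_eq_zero f hb', hb']
          exact le_of_eq (by ring)
        · have hb' : 1 ≤ fiberCard f b := by unfold fiberCard; exact_mod_cast hb
          refine le_of_eq_of_le ?_ (laplacian_fiber_bound hd1 hd2 hb')
          ring
      have hc := dotProduct_comm y (fiberMatrix f *ᵥ x)
      rw [hc]
      linarith)
  refine h.trans_eq ?_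
  have hg (b : β) : d / (fiberCard f b + 1) * ((-s) ^ 2 * fiberCard f b + 1) = d := by
    rw [neg_sq, hs, one_mul, div_mul_cancel₀ _ (hm b).ne']
  simp only [hg, Finset.sum_const, Finset.card_univ, nsmul_eq_mul]
  -- The trace is `(d - 1)|α| + d|β| = |α|`, by `hdm`.
  linarith

end SGB

/-! ### Comparison with complete graphs -/

namespace SGB

variable {V : Type*} [Fintype V] [Nonempty V] (Γ : SimpleGraph V)

theorem not_isHyperenergetic_of_le (h : energy Γ ≤ 2 * ((Fintype.card V : ℝ) - 1)) :
    ¬ IsHyperenergetic Γ := by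
  have h' := two_mul_le_energy (isRegularOfDegree_top (V := Fin (Fintype.card V)))
  rw [Fintype.card_fin, Nat.cast_sub Fintype.card_pos, Nat.cast_one] at h'
  exact not_lt.2 (h.trans h')

theorem not_isLHyperenergetic_of_le (h : lapEnergy Γ ≤ 2 * ((Fintype.card V : ℝ) - 1)) :
    ¬ IsLHyperenergetic Γ := by
  have h' := two_mul_le_sum_abs_degMatrix (isRegularOfDegree_top (V := Fin (Fintype.card V)))
    (s := -1) (by simp)
  rw [← lapEnergy_eq, Fintype.card_fin, Nat.cast_sub Fintype.card_pos, Nat.cast_one] at h'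
  exact not_lt.2 (h.trans h')

theorem not_isQHyperenergetic_of_le (h : signlessLapEnergy Γ ≤ 2 * ((Fintype.card V : ℝ) - 1)) :
    ¬ IsQHyperenergetic Γ := by
  have h' := two_mul_le_sum_abs_degMatrix (isRegularOfDegree_top (V := Fin (Fintype.card V)))
    (s := 1) (by simp)
  rw [← signlessLapEnergy_eq, Fintype.card_fin, Nat.cast_sub Fintype.card_pos, Nat.cast_one] at h'
  exact not_lt.2 (h.trans h')

theorem not_isCNHyperenergetic_of_le
    (h : cnEnergy Γ ≤ 2 * (((Fintype.card V : ℝ) - 1) * ((Fintype.card V : ℝ) - 2))) :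
    ¬ IsCNHyperenergetic Γ := by
  have h' := cnEnergy_top_ge (V := Fin (Fintype.card V))
  rw [Fintype.card_fin] at h'
  exact not_lt.2 (h.trans h')

/-- If `f` has a domain more than twice as large as its codomain, then its graph is hypoenergetic
and not hyperenergetic in any of the four senses. -/
theorem hypoenergetic_ofFun {α β : Type*} [inst : Fintype (α ⊕ β)] [Nonempty β] (f : α → β)
    (h : 2 * Nat.card β < Nat.card α) :
    IsHypoenergetic (SimpleGraph.ofFun f) ∧ ¬ IsHyperenergetic (SimpleGraph.ofFun f) ∧
      ¬ IsLHyperenergetic (SimpleGraph.ofFun f) ∧ ¬ IsQHyperenergetic (SimpleGraph.ofFun f) ∧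
      ¬ IsCNHyperenergetic (SimpleGraph.ofFun f) := by
  classical
  have : Finite α := Finite.sum_left β
  have : Finite β := Finite.sum_right α
  have := Fintype.ofFinite α
  have := Fintype.ofFinite β
  -- The instance is arbitrary in the statement because `vertexFintype` is not built as the sum
  -- instance.
  obtain rfl : inst = instFintypeSum α β := Subsingleton.elim _ _
  rw [Nat.card_eq_fintype_card, Nat.card_eq_fintype_card] at h
  have hβ : (1 : ℝ) ≤ Fintype.card β := by exact_mod_cast Nat.succ_le_of_lt Fintype.card_pos
  have hN : 2 * (Fintype.card β : ℝ) + 1 ≤ Fintype.card α := by exact_mod_cast h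
  have hcard : (Fintype.card (α ⊕ β) : ℝ) = Fintype.card α + Fintype.card β := by simp
  have hE := energy_ofFun_le f
  have hle : Fintype.card β ≤ Fintype.card α := by omega
  refine ⟨?_, not_isHyperenergetic_of_le _ ?_, not_isLHyperenergetic_of_le _ ?_,
    not_isQHyperenergetic_of_le _ ?_, not_isCNHyperenergetic_of_le _ ?_⟩
  · rw [IsHypoenergetic, hcard]
    linarith
  · rw [hcard]
    linarith
  · rw [lapEnergy_eq, hcard]
    exact (sum_abs_degMatrix_ofFun_le f hle (by norm_num)).trans (by linarith)
  · rw [signlessLapEnergy_eq, hcard]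
    exact (sum_abs_degMatrix_ofFun_le f hle (by norm_num)).trans (by linarith)
  · refine (cnEnergy_ofFun_le f).trans ?_
    rw [hcard]
    nlinarith

end SGB

theorem mainTheorem8 (p : ℕ) [Fact p.Prime] :
    Fintype.card (SGB.Vertex (DihedralGroup (p ^ 2))) = 4 * p ^ 4 + p ^ 2 + p + 4 ∧
    SGB.IsHypoenergetic (SGB.sgbGraph (DihedralGroup (p ^ 2))) ∧
    ¬ SGB.IsHyperenergetic (SGB.sgbGraph (DihedralGroup (p ^ 2))) ∧
    ¬ SGB.IsLHyperenergetic (SGB.sgbGraph (DihedralGroup (p ^ 2))) ∧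
    ¬ SGB.IsQHyperenergetic (SGB.sgbGraph (DihedralGroup (p ^ 2))) ∧
    ¬ SGB.IsCNHyperenergetic (SGB.sgbGraph (DihedralGroup (p ^ 2))) := by
  have hp : 2 ≤ p := (Fact.out : p.Prime).two_le
  have hk := DihedralGroup.card_subgroup_prime_sq p
  have hN : Nat.card (DihedralGroup (p ^ 2) × DihedralGroup (p ^ 2)) = 4 * p ^ 4 := by
    rw [Nat.card_prod, DihedralGroup.nat_card]
    ring
  refine ⟨?_, ?_⟩
  · rw [← Nat.card_eq_fintype_card, Nat.card_sum, hN, hk]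
    ring
  · rw [sgbGraph_eq_ofFun]
    refine hypoenergetic_ofFun _ ?_
    rw [hN, hk]
    nlinarith [Nat.pow_le_pow_left hp 2, Nat.mul_le_mul hp hp]
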